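/- Let $S^2=\{x\in\mathbb R^3:\ |x|=1\}$ be the unit sphere with the round (geodesic) metric $d(x,y)=\arccos\langle x,y\rangle$. For a Lipschitz function $f\colon S^2\to\mathbb C$ write $$L(f)=\sup\Big\{\frac{|f(x)-f(y)|}{d(x,y)} : x,y\in S^2,\ x\ne y\Big\}$$ for its Lipschitz constant, and let $\mathcal O(S^2)\subseteq C(S^2)$ be the unital complex algebra generated by the three coordinate functions $x_1,x_2,x_3$ of $S^2\subseteq\mathbb R^3$. Then for every Lipschitz function $f\colon S^2\to\mathbb C$ and every $\varepsilon>0$ there exists $p\in\mathcal O(S^2)$, itself Lipschitz, with $$L(p)\le L(f)\qquad\text{and}\qquad \|f-p\|_\infty\le\varepsilon\cdot L(f),$$ and the second inequality is strict whenever $f$ is not constant. -/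

import Mathlib

noncomputable section

namespace RoundSphere

/-- The unit sphere `S²` in Euclidean `ℝ³`, with its (compact) subspace topology. -/
abbrev S2 : Type := Metric.sphere (0 : EuclideanSpace ℝ (Fin 3)) 1

/-- The round (geodesic, great-circle) distance on `S²`: the angle `arccos ⟨x, y⟩` between the
unit vectors `x` and `y`. It is not the chordal distance that `S2` inherits from `ℝ³`. -/
def roundDist (x y : S2) : ℝ :=
  InnerProductGeometry.angle (x : EuclideanSpace ℝ (Fin 3)) (y : EuclideanSpace ℝ (Fin 3))

/-- `f` is Lipschitz with respect to the round distance. -/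
def IsLipschitz (f : S2 → ℂ) : Prop :=
  ∃ K : ℝ, ∀ x y : S2, ‖f x - f y‖ ≤ K * roundDist x y

/-- The Lipschitz constant `L(f) = sup { |f x - f y| / d(x, y) : x ≠ y }` with respect to the
round distance; the set is bounded above precisely when `f` satisfies `IsLipschitz`. -/
def lipConst (f : S2 → ℂ) : ℝ :=
  sSup {r : ℝ | ∃ x y : S2, x ≠ y ∧ r = ‖f x - f y‖ / roundDist x y}

/-- The coordinate function `x_i` on `S²`, as a complex-valued continuous function. -/
def coordFn (i : Fin 3) : C(S2, ℂ) where
  toFun x := (((x : EuclideanSpace ℝ (Fin 3)) i : ℝ) : ℂ)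
  continuous_toFun := by fun_prop

/-- The coordinate algebra `O(S²)`: the unital complex subalgebra of `C(S²)` generated by the three
coordinate functions, i.e. the polynomial functions on `S²` with complex coefficients. -/
def coordAlgebra : Subalgebra ℂ C(S2, ℂ) :=
  Algebra.adjoin ℂ (Set.range coordFn)

end RoundSphere

end

open MeasureTheory Filter Topology InnerProductGeometry

namespace RoundSphere

section Rotation

variable {V : Type*} [NormedAddCommGroup V] [InnerProductSpace ℝ V]

/-- Nonnegativity of the Gram determinant of `x`, `x'`, `y`, where `x`, `x'` are unit vectors. -/
theorem gram_det_nonneg {x x' : V} (hx : ‖x‖ = 1) (hx' : ‖x'‖ = 1) (y : V) :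
    0 ≤ (1 - inner ℝ x x' ^ 2) * ‖y‖ ^ 2 + 2 * inner ℝ x x' * inner ℝ x y * inner ℝ x' y
      - inner ℝ x y ^ 2 - inner ℝ x' y ^ 2 := by
  set t := inner ℝ x x' with ht
  set a := inner ℝ x y with ha
  set b := inner ℝ x' y with hb
  have hxx : inner ℝ x x = (1 : ℝ) := by simp [hx]
  have hxx' : inner ℝ x' x' = (1 : ℝ) := by simp [hx']
  have hyy : inner ℝ y y = ‖y‖ ^ 2 := real_inner_self_eq_norm_sq y
  -- the component of `y` orthogonal to `x`, and likewise for `x'`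
  have hu : inner ℝ (y - a • x) (y - a • x) = ‖y‖ ^ 2 - a ^ 2 := by
    simp only [inner_sub_left, inner_sub_right, real_inner_smul_left, real_inner_smul_right,
      hxx, hyy, real_inner_comm x y, ← ha]
    ring
  have hv : inner ℝ (x' - t • x) (x' - t • x) = 1 - t ^ 2 := by
    simp only [inner_sub_left, inner_sub_right, real_inner_smul_left, real_inner_smul_right,
      hxx, hxx', real_inner_comm x x', ← ht]
    ring
  have huv : inner ℝ (y - a • x) (x' - t • x) = b - t * a := by
    simp only [inner_sub_left, inner_sub_right, real_inner_smul_left, real_inner_smul_right,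
      hxx, real_inner_comm x y, real_inner_comm x' y, ← ht, ← ha, ← hb]
    ring
  have h := real_inner_mul_inner_self_le (y - a • x) (x' - t • x)
  rw [hu, hv, huv] at h
  nlinarith [h]

/-- Any unit vector is moved to any other one by a linear isometry that displaces no vector
by a larger angle. -/
theorem exists_linearIsometryEquiv_angle_le {x x' : V} (hx : ‖x‖ = 1) (hx' : ‖x'‖ = 1) :
    ∃ R : V ≃ₗᵢ[ℝ] V, R x = x' ∧ ∀ y, y ≠ 0 → angle (R y) y ≤ angle x' x := by
  by_cases hanti : x' = -x
  · refine ⟨LinearIsometryEquiv.neg ℝ, by simp [hanti], fun y _ => ?_⟩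
    have hx0 : x ≠ 0 := by rintro rfl; simp at hx
    rw [hanti, angle_neg_self_of_nonzero hx0]
    exact angle_le_pi _ _
  set t := inner ℝ x x' with ht
  have hxx : inner ℝ x x = (1 : ℝ) := by simp [hx]
  have hxx' : inner ℝ x' x' = (1 : ℝ) := by simp [hx']
  have hm : ‖x + x'‖ ^ 2 = 2 * (1 + t) := by
    rw [norm_add_sq_real, hx, hx']; ring
  have hpos : 0 < 1 + t := by
    have h0 : x + x' ≠ 0 := fun h => hanti (eq_neg_of_add_eq_zero_right h)
    have := pow_pos (norm_pos_iff.2 h0) 2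
    linarith
  have hne : 1 + t ≠ 0 := hpos.ne'
  let sx := (ℝ ∙ x).reflection
  let sm := (ℝ ∙ (x + x')).reflection
  have hsx (y : V) : sx y = (2 * inner ℝ x y) • x - y := by
    simp only [sx, Submodule.reflection_singleton_apply, hx]
    simp [two_smul, add_smul, two_mul]
  have hsm (y : V) : sm y = (inner ℝ (x + x') y / (1 + t)) • (x + x') - y := by
    simp only [sm, Submodule.reflection_singleton_apply]
    have h2 : ((‖x + x'‖ : ℝ) : ℝ) ^ 2 = 2 * (1 + t) := hm
    simp only [RCLike.ofReal_real_eq_id, id, h2, ← Nat.cast_smul_eq_nsmul ℝ, smul_smul]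
    congr 2
    field_simp
    exact mul_comm _ _
  refine ⟨sx.trans sm, ?_, fun y hy => ?_⟩
  · have h1 : sx x = x := by rw [hsx, hxx]; module
    have h2 : inner ℝ (x + x') x / (1 + t) = 1 := by
      rw [inner_add_left, hxx, real_inner_comm, ← ht, div_self hne]
    simp [h1, hsm, h2]
  · have hin : inner ℝ (sm (sx y)) y = inner ℝ (sx y) (sm y) := by
      have := sm.inner_map_map (sx y) (sm y)
      rwa [show sm (sm y) = y from Submodule.reflection_reflection _ y] at this
    have hnorm : ‖sm (sx y)‖ = ‖y‖ := by simp
    have hy0 : 0 < ‖y‖ := norm_pos_iff.2 hy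
    have hcalc : inner ℝ (sx y) (sm y) = 2 * inner ℝ x y * inner ℝ x' y + ‖y‖ ^ 2
        - (inner ℝ x y + inner ℝ x' y) ^ 2 / (1 + t) := by
      rw [hsx, hsm]
      simp only [inner_sub_left, inner_sub_right, real_inner_smul_left, real_inner_smul_right,
        inner_add_left, inner_add_right, hxx, ← ht, real_inner_self_eq_norm_sq y,
        real_inner_comm x y, real_inner_comm x' y]
      field_simp
      ring
    have hG := gram_det_nonneg hx hx' y
    rw [← ht] at hG
    show angle (sm (sx y)) y ≤ _
    unfold angle
    rw [hin, hnorm, hcalc, hx, hx', real_inner_comm x x', ← ht]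
    apply Real.antitone_arccos
    rw [mul_one, div_one, le_div_iff₀ (by positivity), ← sub_nonneg]
    have : 2 * inner ℝ x y * inner ℝ x' y + ‖y‖ ^ 2
        - (inner ℝ x y + inner ℝ x' y) ^ 2 / (1 + t) - t * (‖y‖ * ‖y‖)
        = ((1 - t ^ 2) * ‖y‖ ^ 2 + 2 * t * inner ℝ x y * inner ℝ x' y
          - inner ℝ x y ^ 2 - inner ℝ x' y ^ 2) / (1 + t) := by
      field_simp
      ring
    rw [this]
    exact div_nonneg hG hpos.le

end Rotation

/-- Euclidean three-space. -/
local notation "E" => EuclideanSpace ℝ (Fin 3)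

/-- The closed unit ball of Euclidean three-space. -/
local notation "B" => Metric.closedBall (0 : EuclideanSpace ℝ (Fin 3)) 1

theorem norm_coe (x : S2) : ‖(x : E)‖ = 1 := by simp

theorem coe_ne_zero (x : S2) : (x : E) ≠ 0 := by
  intro h
  have := norm_coe x
  simp [h] at this

/-- The first unit vector, as a point of the sphere. -/
noncomputable def basePoint : S2 := ⟨EuclideanSpace.single 0 1, by simp⟩

open Classical in
/-- Radial projection to the sphere (with the base point as value at the origin). -/
noncomputable def radialProj (y : E) : S2 :=
  ⟨if y = 0 then basePoint else ‖y‖⁻¹ • y, by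
    split_ifs with h
    · exact basePoint.2
    · simp [norm_smul, h]⟩

theorem coe_radialProj {y : E} (hy : y ≠ 0) : (radialProj y : E) = ‖y‖⁻¹ • y := by
  simp [radialProj, hy]

theorem measurable_radialProj : Measurable radialProj := by
  classical
  refine Measurable.subtype_mk (Measurable.ite (measurableSet_singleton 0) measurable_const ?_)
  fun_prop

theorem roundDist_radialProj {y z : E} (hy : y ≠ 0) (hz : z ≠ 0) :
    roundDist (radialProj y) (radialProj z) = angle y z := by
  rw [roundDist, coe_radialProj hy, coe_radialProj hz,
    angle_smul_left_of_pos _ _ (by positivity), angle_smul_right_of_pos _ _ (by positivity)]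

theorem roundDist_radialProj_left {y : E} (hy : y ≠ 0) (x : S2) :
    roundDist (radialProj y) x = angle y x := by
  rw [roundDist, coe_radialProj hy, angle_smul_left_of_pos _ _ (by positivity)]

theorem roundDist_nonneg (x y : S2) : 0 ≤ roundDist x y := angle_nonneg _ _

theorem roundDist_self (x : S2) : roundDist x x = 0 := angle_self (coe_ne_zero x)

theorem roundDist_pos {x y : S2} (h : x ≠ y) : 0 < roundDist x y := by
  refine (roundDist_nonneg x y).lt_of_ne' fun h0 => h (Subtype.ext ?_)
  have h1 : inner ℝ (x : E) y = 1 := by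
    have := inner_eq_mul_norm_iff_angle_eq_zero (coe_ne_zero x) (coe_ne_zero y) |>.2 h0
    rwa [norm_coe, norm_coe, one_mul] at this
  exact (inner_eq_one_iff_of_norm_eq_one (norm_coe x) (norm_coe y)).1 h1

theorem lipConst_le {f : S2 → ℂ} {K : ℝ} (h : ∀ x y, ‖f x - f y‖ ≤ K * roundDist x y) :
    lipConst f ≤ K := by
  refine csSup_le ⟨_, basePoint, -basePoint, ?_, rfl⟩ ?_
  · exact (ne_neg_of_mem_unit_sphere ℝ basePoint)
  · rintro r ⟨x, y, hxy, rfl⟩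
    exact (div_le_iff₀ (roundDist_pos hxy)).2 (h x y)

theorem IsLipschitz.norm_sub_le {f : S2 → ℂ} (hf : IsLipschitz f) (x y : S2) :
    ‖f x - f y‖ ≤ lipConst f * roundDist x y := by
  obtain ⟨K, hK⟩ := hf
  rcases eq_or_ne x y with rfl | hxy
  · simp [roundDist_self]
  refine (div_le_iff₀ (roundDist_pos hxy)).1 (le_csSup ⟨K, ?_⟩ ⟨x, y, hxy, rfl⟩)
  rintro r ⟨x', y', hxy', rfl⟩
  exact (div_le_iff₀ (roundDist_pos hxy')).2 (hK x' y')

theorem integrableOn_kernel_smul (n : ℕ) (x : S2) {F : Type*} [NormedAddCommGroup F]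
    [NormedSpace ℝ F] {G : E → F} (hG : IntegrableOn G B) :
    IntegrableOn (fun y => (1 + inner ℝ (x : E) y) ^ n • G y) B :=
  hG.continuousOn_smul (by fun_prop) (isCompact_closedBall _ _)

/-- Integrals of zonal kernels against a fixed density are polynomial functions on the sphere. -/
theorem exists_mem_coordAlgebra_eq_integral (n : ℕ) :
    ∀ G : E → ℂ, IntegrableOn G B → ∃ q ∈ coordAlgebra, ∀ x : S2,
      q x = ∫ y in B, (1 + inner ℝ (x : E) y) ^ n • G y := by
  induction n with
  | zero =>
    intro G _
    exact ⟨algebraMap ℂ _ (∫ y in B, G y), Subalgebra.algebraMap_mem _ _, fun x => by simp⟩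
  | succ n ih =>
    intro G hG
    have hGi (i : Fin 3) : IntegrableOn (fun y : E => y i • G y) B :=
      hG.continuousOn_smul (f := fun y : E => y i)
        (PiLp.continuous_apply 2 _ i).continuousOn (isCompact_closedBall _ _)
    obtain ⟨q, hq, hqe⟩ := ih G hG
    choose r hr hre using fun i => ih _ (hGi i)
    refine ⟨q + ∑ i, coordFn i * r i, add_mem hq (sum_mem fun i _ => mul_mem
      (Algebra.subset_adjoin ⟨i, rfl⟩) (hr i)), fun x => ?_⟩
    have hsum : ∀ y : E, (1 + inner ℝ (x : E) y) ^ (n + 1) • G y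
        = (1 + inner ℝ (x : E) y) ^ n • G y
          + ∑ i, (x : E) i • ((1 + inner ℝ (x : E) y) ^ n • (y i • G y)) := by
      intro y
      have : inner ℝ (x : E) y = ∑ i, (x : E) i * y i := by
        simp [PiLp.inner_apply, mul_comm]
      conv_lhs => rw [pow_succ, mul_add, mul_one, add_smul]
      congr 1
      conv_lhs => rw [this, Finset.mul_sum, Finset.sum_smul, ← this]
      refine Finset.sum_congr rfl fun i _ => ?_
      simp only [smul_smul]
      congr 1
      ring
    have hterm (i : Fin 3) : IntegrableOn
        (fun y : E => (x : E) i • ((1 + inner ℝ (x : E) y) ^ n • (y i • G y))) B :=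
      (integrableOn_kernel_smul n x (hGi i)).smul ((x : E) i)
    simp_rw [hsum]
    rw [integral_add (integrableOn_kernel_smul n x hG) (integrable_finsetSum _ fun i _ => hterm i),
      integral_finsetSum _ fun i _ => hterm i]
    simp_rw [integral_smul]
    simp [hqe, hre, coordFn]

/-- Change of variables by a linear isometry in an integral over the unit ball. -/
theorem setIntegral_comp_linearIsometryEquiv {F : Type*} [NormedAddCommGroup F] [NormedSpace ℝ F]
    (R : E ≃ₗᵢ[ℝ] E) (g : E → F) : ∫ y in B, g (R y) = ∫ y in B, g y := by
  have h := R.measurePreserving.setIntegral_preimage_emb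
    R.toHomeomorph.measurableEmbedding g B
  rwa [R.preimage_closedBall, map_zero] at h

/-- The total mass of the `n`-th zonal kernel. -/
noncomputable def kernelMass (n : ℕ) : ℝ := ∫ y in B, (1 + inner ℝ (basePoint : E) y) ^ n

/-- The mean angle to the pole under the `n`-th zonal kernel. -/
noncomputable def kernelSpread (n : ℕ) : ℝ :=
  (kernelMass n)⁻¹ * ∫ y in B, (1 + inner ℝ (basePoint : E) y) ^ n * angle y (basePoint : E)

theorem one_add_inner_nonneg (x : S2) {y : E} (hy : y ∈ B) : 0 ≤ 1 + inner ℝ (x : E) y := by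
  have h := abs_real_inner_le_norm (x : E) y
  rw [norm_coe, one_mul] at h
  have hy' : ‖y‖ ≤ 1 := by simpa using hy
  linarith [neg_abs_le (inner ℝ (x : E) y)]

theorem integral_kernel (n : ℕ) (x : S2) :
    ∫ y in B, (1 + inner ℝ (x : E) y) ^ n = kernelMass n := by
  obtain ⟨R, hR, -⟩ := exists_linearIsometryEquiv_angle_le (norm_coe basePoint) (norm_coe x)
  rw [← setIntegral_comp_linearIsometryEquiv R, kernelMass]
  simp [← hR]

theorem integral_kernel_mul_angle (n : ℕ) (x : S2) :
    ∫ y in B, (1 + inner ℝ (x : E) y) ^ n * angle y (x : E)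
      = ∫ y in B, (1 + inner ℝ (basePoint : E) y) ^ n * angle y (basePoint : E) := by
  obtain ⟨R, hR, -⟩ := exists_linearIsometryEquiv_angle_le (norm_coe basePoint) (norm_coe x)
  rw [← setIntegral_comp_linearIsometryEquiv R]
  simp [← hR, LinearIsometryEquiv.inner_map_map, angle]

theorem kernelMass_pos (n : ℕ) : 0 < kernelMass n := by
  have hc : Continuous fun y : E => (1 + inner ℝ (basePoint : E) y) ^ n := by fun_prop
  rw [kernelMass, setIntegral_pos_iff_support_of_nonneg_ae
    (ae_restrict_of_forall_mem measurableSet_closedBall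
      fun y hy => pow_nonneg (one_add_inner_nonneg basePoint hy) n)
    (hc.continuousOn.integrableOn_compact (isCompact_closedBall _ _))]
  refine (Metric.measure_ball_pos volume (0 : E) one_pos).trans_le (measure_mono fun y hy => ?_)
  refine ⟨?_, Metric.ball_subset_closedBall hy⟩
  have h := abs_real_inner_le_norm (basePoint : E) y
  rw [norm_coe, one_mul] at h
  have hy' : ‖y‖ < 1 := by simpa using hy
  have : 0 < 1 + inner ℝ (basePoint : E) y := by
    linarith [neg_abs_le (inner ℝ (basePoint : E) y)]
  exact (pow_pos this n).ne'

theorem integrableOn_angle (x : S2) : IntegrableOn (fun y : E => angle y (x : E)) B := by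
  refine Measure.integrableOn_of_bounded (M := Real.pi) (by
    exact (isCompact_closedBall _ _).measure_lt_top.ne) ?_ ?_
  · have : Measurable fun y : E => angle y (x : E) := by
      unfold angle
      fun_prop
    exact this.aestronglyMeasurable
  · refine Eventually.of_forall fun y => ?_
    rw [Real.norm_of_nonneg (angle_nonneg _ _)]
    exact angle_le_pi _ _

theorem tendsto_kernelSpread : Tendsto kernelSpread atTop (𝓝 0) := by
  have hc : Continuous fun y : E => 1 + inner ℝ (basePoint : E) y := by fun_prop
  have hself : inner ℝ (basePoint : E) (basePoint : E) = (1 : ℝ) := by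
    rw [real_inner_self_eq_norm_sq, norm_coe, one_pow]
  have h := tendsto_setIntegral_pow_smul_of_unique_maximum_of_isCompact_of_integrableOn
    (μ := (volume : Measure E)) (s := B) (x₀ := (basePoint : E))
    (c := fun y => 1 + inner ℝ (basePoint : E) y) (g := fun y => angle y (basePoint : E))
    (isCompact_closedBall _ _) hc.continuousOn ?_ (fun y hy => one_add_inner_nonneg _ hy)
    (by rw [hself]; norm_num) ?_ (integrableOn_angle _) ?_
  · simp only [angle_self (coe_ne_zero basePoint), smul_eq_mul] at h
    exact h
  · intro y hy hne
    have hy' : ‖y‖ ≤ 1 := by simpa using hy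
    have h1 := real_inner_le_norm (basePoint : E) y
    rw [norm_coe, one_mul] at h1
    rw [hself]
    refine add_lt_add_right (lt_of_le_of_ne (h1.trans hy') fun h2 => hne ?_) 1
    have h3 : ‖y‖ = 1 := le_antisymm hy' (h2 ▸ h1)
    exact ((inner_eq_one_iff_of_norm_eq_one (norm_coe _) h3).1 h2).symm
  · rw [interior_closedBall _ one_ne_zero, closure_ball _ one_ne_zero]
    simp
  · have h0 := continuousAt_angle (x := ((basePoint : E), (basePoint : E)))
      (coe_ne_zero _) (coe_ne_zero _)
    exact (ContinuousAt.comp (f := fun y : E => (y, (basePoint : E))) h0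
      (by fun_prop)).continuousWithinAt

section Smoothing

variable (f : C(S2, ℂ))

theorem integrableOn_comp_radialProj (R : E ≃ₗᵢ[ℝ] E) :
    IntegrableOn (fun y => f (radialProj (R y))) B := by
  refine Measure.integrableOn_of_bounded (M := ‖f‖)
    (isCompact_closedBall _ _).measure_lt_top.ne ?_
    (Eventually.of_forall fun y => f.norm_coe_le_norm _)
  exact (f.continuous.measurable.comp
    (measurable_radialProj.comp R.continuous.measurable)).aestronglyMeasurable

/-- The `n`-th zonal mean of `f` at `x`. -/
noncomputable def zonalMean (n : ℕ) (x : S2) : ℂ :=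
  (kernelMass n)⁻¹ • ∫ y in B, (1 + inner ℝ (x : E) y) ^ n • f (radialProj y)

theorem exists_mem_coordAlgebra_eq_zonalMean (n : ℕ) :
    ∃ p ∈ coordAlgebra, ∀ x, p x = zonalMean f n x := by
  obtain ⟨q, hq, hqe⟩ := exists_mem_coordAlgebra_eq_integral n (fun y => f (radialProj y))
    (integrableOn_comp_radialProj f (.refl ℝ E))
  refine ⟨((kernelMass n)⁻¹ : ℂ) • q, Subalgebra.smul_mem _ hq _, fun x => ?_⟩
  simp [zonalMean, hqe]

variable {f}

theorem norm_zonalMean_sub_le {K : ℝ} (hf : ∀ x y, ‖f x - f y‖ ≤ K * roundDist x y)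
    (hK : 0 ≤ K) (n : ℕ) (x x' : S2) :
    ‖zonalMean f n x - zonalMean f n x'‖ ≤ K * roundDist x x' := by
  obtain ⟨R, hR, hRa⟩ := exists_linearIsometryEquiv_angle_le (norm_coe x') (norm_coe x)
  have hrot : ∫ y in B, (1 + inner ℝ (x : E) y) ^ n • f (radialProj y)
      = ∫ y in B, (1 + inner ℝ (x' : E) y) ^ n • f (radialProj (R y)) := by
    rw [← setIntegral_comp_linearIsometryEquiv R]
    simp [← hR]
  have hmove (y : E) : ‖f (radialProj (R y)) - f (radialProj y)‖ ≤ K * roundDist x x' := by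
    rcases eq_or_ne y 0 with rfl | hy
    · simpa using mul_nonneg hK (roundDist_nonneg x x')
    · refine (hf _ _).trans (mul_le_mul_of_nonneg_left ?_ hK)
      rw [roundDist_radialProj (by simpa using hy) hy]
      exact hRa y hy
  have hfi : IntegrableOn (fun y => f (radialProj y)) B :=
    integrableOn_comp_radialProj f (.refl ℝ E)
  rw [zonalMean, zonalMean, hrot, ← smul_sub, ← integral_sub
    (integrableOn_kernel_smul n x' (integrableOn_comp_radialProj f R))
    (integrableOn_kernel_smul n x' hfi),
    norm_smul, Real.norm_of_nonneg (inv_nonneg.2 (kernelMass_pos n).le),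
    inv_mul_le_iff₀ (kernelMass_pos n), ← integral_kernel n x', ← integral_mul_const]
  refine norm_integral_le_of_norm_le (integrableOn_kernel_smul n x'
    (G := fun _ => K * roundDist x x') (integrableOn_const
      (isCompact_closedBall _ _).measure_lt_top.ne)) (ae_restrict_of_forall_mem
      measurableSet_closedBall fun y hy => ?_)
  rw [← smul_sub, norm_smul,
    Real.norm_of_nonneg (pow_nonneg (one_add_inner_nonneg x' hy) n)]
  exact mul_le_mul_of_nonneg_left (hmove y) (pow_nonneg (one_add_inner_nonneg x' hy) n)

theorem norm_sub_zonalMean_le {K : ℝ} (hf : ∀ x y, ‖f x - f y‖ ≤ K * roundDist x y)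
    (n : ℕ) (x : S2) : ‖f x - zonalMean f n x‖ ≤ kernelSpread n * K := by
  have hconst : IntegrableOn (fun _ : E => f x) B :=
    integrableOn_const (isCompact_closedBall _ _).measure_lt_top.ne
  have hfx : f x = (kernelMass n)⁻¹ • ∫ y in B, (1 + inner ℝ (x : E) y) ^ n • f x := by
    rw [integral_smul_const, integral_kernel, smul_smul, inv_mul_cancel₀ (kernelMass_pos n).ne',
      one_smul]
  have hfi : IntegrableOn (fun y => f (radialProj y)) B :=
    integrableOn_comp_radialProj f (.refl ℝ E)
  rw [norm_sub_rev, zonalMean, hfx, ← smul_sub, ← integral_sub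
    (integrableOn_kernel_smul n x hfi)
    (integrableOn_kernel_smul n x hconst),
    norm_smul, Real.norm_of_nonneg (inv_nonneg.2 (kernelMass_pos n).le), kernelSpread, mul_assoc]
  refine mul_le_mul_of_nonneg_left ?_ (inv_nonneg.2 (kernelMass_pos n).le)
  rw [← integral_kernel_mul_angle n x, ← integral_mul_const]
  have hne : ∀ᵐ y : E ∂(volume.restrict B), y ≠ 0 :=
    ae_restrict_of_ae (Measure.ae_ne volume 0)
  refine norm_integral_le_of_norm_le ((integrableOn_kernel_smul n x
    (integrableOn_angle x)).mul_const K) ?_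
  filter_upwards [hne, ae_restrict_mem measurableSet_closedBall] with y hy0 hy
  have hnn := pow_nonneg (one_add_inner_nonneg x hy) n
  rw [← smul_sub, norm_smul, Real.norm_of_nonneg hnn, mul_assoc, mul_comm (angle y (x : E)) K,
    ← roundDist_radialProj_left hy0]
  exact mul_le_mul_of_nonneg_left (hf _ _) hnn

end Smoothing

end RoundSphere

theorem mainTheorem6 (f : C(RoundSphere.S2, ℂ)) (hf : RoundSphere.IsLipschitz f)
    (ε : ℝ) (hε : 0 < ε) :
    ∃ p ∈ RoundSphere.coordAlgebra,
      RoundSphere.IsLipschitz p ∧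
      RoundSphere.lipConst p ≤ RoundSphere.lipConst f ∧
      ‖f - p‖ ≤ ε * RoundSphere.lipConst f ∧
      ((∃ x y : RoundSphere.S2, f x ≠ f y) → ‖f - p‖ < ε * RoundSphere.lipConst f) := by
  have hL := hf.norm_sub_le
  have hL0 : 0 ≤ RoundSphere.lipConst f := by
    refine Real.sSup_nonneg ?_
    rintro r ⟨x, y, -, rfl⟩
    exact div_nonneg (norm_nonneg _) (RoundSphere.roundDist_nonneg x y)
  obtain ⟨n, hn⟩ := (RoundSphere.tendsto_kernelSpread.eventually_lt_const hε).exists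
  obtain ⟨p, hp, hpe⟩ := RoundSphere.exists_mem_coordAlgebra_eq_zonalMean f n
  have hpL (x y : RoundSphere.S2) :
      ‖p x - p y‖ ≤ RoundSphere.lipConst f * RoundSphere.roundDist x y := by
    rw [hpe, hpe]
    exact RoundSphere.norm_zonalMean_sub_le hL hL0 n x y
  have : Nonempty RoundSphere.S2 := ⟨RoundSphere.basePoint⟩
  have hfp : ‖f - p‖ ≤ RoundSphere.kernelSpread n * RoundSphere.lipConst f := by
    refine (ContinuousMap.norm_le_of_nonempty _).2 fun x => ?_
    rw [ContinuousMap.sub_apply, hpe]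
    exact RoundSphere.norm_sub_zonalMean_le hL n x
  refine ⟨p, hp, ⟨_, hpL⟩, RoundSphere.lipConst_le hpL,
    hfp.trans (mul_le_mul_of_nonneg_right hn.le hL0), ?_⟩
  rintro ⟨x, y, hxy⟩
  have hpos : 0 < RoundSphere.lipConst f := by
    refine hL0.lt_of_ne fun h0 => hxy (sub_eq_zero.1 (norm_le_zero_iff.1 ?_))
    simpa [← h0] using hL x y
  exact hfp.trans_lt (mul_lt_mul_of_pos_right hn hpos)
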